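/- All graphs are finite, without loops or multiple edges. For a graph $H$, a graph $G$ is $H$-free if it has no induced subgraph isomorphic to $H$; $P_4$ denotes the path on four vertices. A branch decomposition of a graph $G$ is a pair $(T,\delta)$ where $T$ is a tree of maximum degree at most $3$ and $\delta$ is a bijection from $V(G)$ to the leaves of $T$ (the vertex of a one-vertex tree counts as a leaf). Every edge $e$ of $T$ yields a partition $(A_e,\overline{A_e})$ of $V(G)$ according to the two components of $T-e$. The mim-width of $(T,\delta)$ is the maximum, over all edges $e$ of $T$, of the size of a maximum induced matching in the bipartite graph formed by the edges of $G$ between $A_e$ and $\overline{A_e}$ (and $0$ if $T$ has no edge). The mim-width of $G$ is the minimum mim-width of a branch decomposition of $G$. The clique-width of $G$ is the minimum number of labels needed to construct $G$ by the operations: creating a vertex with a label $i$; taking the disjoint union of two labelled graphs; adding all edges between vertices labelled $i$ and vertices labelled $j$, for $i\neq j$; relabelling all vertices labelled $i$ to $j$. Both parameters are $0$ for the graph without vertices. A class of graphs has bounded mim-width (clique-width) if there is a constant $k$ such that every graph in the class has mim-width (clique-width) at most $k$. **Theorem.** Let $H$ be a graph. The class of $H$-free graphs has bounded mim-width if and only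 if $H$ is isomorphic to an induced subgraph of $P_4$. Moreover, the class of $H$-free graphs has bounded mim-width if and only if it has bounded clique-width. -/

import Mathlib

namespace SimpleGraph

/-! ### Mim-width -/

/-- The size of a maximum induced matching in the bipartite graph `G[A, B]` formed by the edges
of `G` with one endpoint in `A` and the other in `B`. An induced matching is a subgraph that is
both a matching and an induced subgraph; its size is its number of edges. -/
noncomputable def cutMim {V : Type*} (G : SimpleGraph V) (A B : Set V) : ℕ :=
  sSup {n : ℕ | ∃ M : (G.between A B).Subgraph,
    M.IsMatching ∧ M.IsInduced ∧ M.edgeSet.ncard = n}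

/-- A branch decomposition `(T, δ)` of a graph with vertex set `V`: a finite tree `T` in which
every vertex has degree at most three, and a bijection `δ` from `V` to the leaves of `T`.
The unique vertex of a one-vertex tree counts as a leaf; in a tree with at least two vertices the
leaves are the vertices of degree exactly one. -/
structure BranchDecomposition (V : Type*) where
  /-- The vertices of the tree. -/
  Node : Type
  finite_node : Finite Node
  /-- The tree. -/
  tree : SimpleGraph Node
  isTree : tree.IsTree
  subcubic : ∀ x : Node, (tree.neighborSet x).ncard ≤ 3
  /-- The bijection to the leaves. -/
  δ : V ≃ {x : Node // (tree.neighborSet x).ncard ≤ 1}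

/-- For an edge `e = xy` of the tree, the set of those vertices of the graph whose leaf lies in the
component of `T - e` that contains `x`. The leaves of the other component correspond to the
complement of this set. -/
def BranchDecomposition.side {V : Type*} (D : BranchDecomposition V) (x y : D.Node) : Set V :=
  {v | (D.tree.deleteEdges {s(x, y)}).Reachable x (D.δ v : D.Node)}

/-- The mim-width of the branch decomposition `D` of `G`: the maximum of `cutMim` over the
partitions `(A_e, V \ A_e)` given by the edges `e` of the tree (and `0` if the tree has no edge).
An edge is given here together with an orientation; the two orientations give the same partition
with its two classes exchanged. -/
noncomputable def BranchDecomposition.mimWidth {V : Type*} (D : BranchDecomposition V)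
    (G : SimpleGraph V) : ℕ :=
  ⨆ d : D.tree.Dart, G.cutMim (D.side d.fst d.snd) (D.side d.fst d.snd)ᶜ

/-- The mim-width of a finite graph: the minimum of the mim-width over all its branch
decompositions. (The graph without vertices, which has no branch decomposition, gets the
value `0`.) -/
noncomputable def mimWidth {V : Type*} (G : SimpleGraph V) : ℕ :=
  sInf {k : ℕ | ∃ D : BranchDecomposition V, D.mimWidth G = k}

/-! ### Clique-width -/

/-- The terms over the four clique-width operations with labels in `Fin k`: create a single vertex
with label `i`; disjoint union; add all edges between the vertices labelled `i` and the vertices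
labelled `j`, where `i ≠ j`; change every label `i` to `j`. -/
inductive CliqueExpr (k : ℕ) : Type
  | vertex (i : Fin k) : CliqueExpr k
  | union (s t : CliqueExpr k) : CliqueExpr k
  | join (i j : Fin k) (h : i ≠ j) (t : CliqueExpr k) : CliqueExpr k
  | relabel (i j : Fin k) (t : CliqueExpr k) : CliqueExpr k

namespace CliqueExpr

/-- The vertex set of the labelled graph built by a term. -/
def Vert {k : ℕ} : CliqueExpr k → Type
  | vertex _ => Unit
  | union s t => s.Vert ⊕ t.Vert
  | join _ _ _ t => t.Vert
  | relabel _ _ t => t.Vert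

/-- The labelling of the graph built by a term. -/
def label {k : ℕ} : (t : CliqueExpr k) → t.Vert → Fin k
  | vertex i => fun _ => i
  | union s t => Sum.elim s.label t.label
  | join _ _ _ t => t.label
  | relabel i j t => fun v => if t.label v = i then j else t.label v

/-- The graph built by a term. -/
def graph {k : ℕ} : (t : CliqueExpr k) → SimpleGraph t.Vert
  | vertex _ => ⊥
  | union s t => s.graph ⊕g t.graph
  | join i j _ t => t.graph ⊔ SimpleGraph.fromRel (fun u v => t.label u = i ∧ t.label v = j)
  | relabel _ _ t => t.graph

end CliqueExpr

/-- The clique-width of a finite graph: the minimum number of labels of a term that builds it.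
(The graph without vertices, which is built by no term, gets the value `0`.) -/
noncomputable def cliqueWidth {V : Type*} (G : SimpleGraph V) : ℕ :=
  sInf {k : ℕ | ∃ t : CliqueExpr k, Nonempty (G ≃g t.graph)}

/-! ### Graph classes -/

/-- A class of graphs. -/
abbrev GraphClass : Type 1 := (V : Type) → SimpleGraph V → Prop

/-- The class of `H`-free graphs: those with no induced subgraph isomorphic to `H`. -/
def freeClass {W : Type*} (H : SimpleGraph W) : GraphClass :=
  fun _ G => ¬ H.IsIndContained G

/-- The finite graphs in the class have bounded mim-width. -/
def HasBoundedMimWidth (C : GraphClass) : Prop :=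
  ∃ k : ℕ, ∀ (V : Type) [Finite V] (G : SimpleGraph V), C V G → G.mimWidth ≤ k

/-- The finite graphs in the class have bounded clique-width. -/
def HasBoundedCliqueWidth (C : GraphClass) : Prop :=
  ∃ k : ℕ, ∀ (V : Type) [Finite V] (G : SimpleGraph V), C V G → G.cliqueWidth ≤ k

end SimpleGraph

/-!
Both equivalences follow from three implications.

If `H` is an induced subgraph of `P₄`, then `H`-free graphs are `P₄`-free, and so have clique-width
at most two: two or more vertices of a `P₄`-free graph can be split into two parts with all edges
or no edge between them (`IsP4Free.isDecomposable`), and two labels suffice to put the parts together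
(`IsP4Free.exists_cliqueExpr`).

Bounded clique-width implies bounded mim-width, as the mim-width of a graph is at most its
clique-width (`mimWidth_le_cliqueWidth`). The syntax tree of a term with `k` labels is a branch
decomposition. The vertices below a node of it have at most `k` different neighbourhoods in the
rest of the graph, and the edges of an induced matching of the cut start in vertices with different
neighbourhoods.

Bounded mim-width forces `H` to be an induced subgraph of `P₄`. The bipartite incidence graphs
between numbers and pairs of numbers (`pairGraph`) have unbounded mim-width, because every branch
decomposition has an edge that splits the numbers in a balanced way
(`IsTree.exists_balanced_edge`). This remains true when one or both sides of the bipartite graph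
are made cliques (`le_mimWidth_pairGraph`). So if `H`-free graphs have bounded mim-width, `H` is an
induced subgraph of a bipartite, of a co-bipartite and of a split graph. Such a graph has at most
four vertices, and it is an induced subgraph of `P₄` (`isIndContained_pathGraph_of_partitions`).
-/

namespace SimpleGraph

/-! ### Induced matchings across a cut -/

/-- A family of pairs `(x i, y i)` whose only adjacencies are `x i ~ y i` is an induced matching
of the cut. Adjacencies among the `x i`, or among the `y i`, play no role: this is why the bound
survives when the vertices on one side of a bipartite graph are joined to each other. -/
lemma le_cutMim {V : Type*} [Finite V] {G : SimpleGraph V} {A B : Set V} (hAB : Disjoint A B)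
    {k : ℕ} (x y : Fin k → V) (hx : ∀ i, x i ∈ A) (hy : ∀ i, y i ∈ B)
    (hadj : ∀ i j, G.Adj (x i) (y j) ↔ i = j) : k ≤ G.cutMim A B := by
  have hne : ∀ i j, x i ≠ y j := fun i j h => hAB.ne_of_mem (hx i) (hy j) h
  have hxinj : Function.Injective x := fun i j h => by
    rw [← hadj i j, h, hadj]
  have hyinj : Function.Injective y := fun i j h => by
    rw [← hadj i j, ← h, hadj]
  have hbet : ∀ u v, u ∈ Set.range x ∪ Set.range y → v ∈ Set.range x ∪ Set.range y →
      ((G.between A B).Adj u v ↔ ∃ i, (u = x i ∧ v = y i) ∨ (u = y i ∧ v = x i)) := by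
    have hxB : ∀ i, x i ∉ B := fun i h => hAB.ne_of_mem (hx i) h rfl
    have hyA : ∀ i, y i ∉ A := fun i h => hAB.ne_of_mem h (hy i) rfl
    have hadj' : ∀ i j, G.Adj (y i) (x j) ↔ i = j := fun i j => by
      rw [G.adj_comm, hadj, eq_comm]
    rintro _ _ (⟨i, rfl⟩ | ⟨i, rfl⟩) (⟨j, rfl⟩ | ⟨j, rfl⟩) <;>
      simp only [between_adj, hadj, hadj', hx, hy, hxB, hyA, hne, fun i j => (hne i j).symm,
        hxinj.eq_iff, hyinj.eq_iff] <;> simp <;> exact eq_comm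
  let M : (G.between A B).Subgraph :=
    (⊤ : (G.between A B).Subgraph).induce (Set.range x ∪ Set.range y)
  have hM : ∀ u v, M.Adj u v ↔ ∃ i, (u = x i ∧ v = y i) ∨ (u = y i ∧ v = x i) := by
    intro u v
    constructor
    · rintro ⟨hu, hv, h⟩
      exact (hbet u v hu hv).1 h
    · rintro ⟨i, h⟩
      have hu : u ∈ Set.range x ∪ Set.range y := by
        rcases h with ⟨rfl, -⟩ | ⟨rfl, -⟩ <;> simp
      have hv : v ∈ Set.range x ∪ Set.range y := by
        rcases h with ⟨-, rfl⟩ | ⟨-, rfl⟩ <;> simp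
      exact ⟨hu, hv, (hbet u v hu hv).2 ⟨i, h⟩⟩
  have hmatch : M.IsMatching := by
    rintro v (⟨i, rfl⟩ | ⟨i, rfl⟩)
    · refine ⟨y i, (hM _ _).2 ⟨i, Or.inl ⟨rfl, rfl⟩⟩, fun w hw => ?_⟩
      obtain ⟨j, ⟨h, rfl⟩ | ⟨h, rfl⟩⟩ := (hM _ _).1 hw
      · rw [hxinj h]
      · exact absurd h (hne _ _)
    · refine ⟨x i, (hM _ _).2 ⟨i, Or.inr ⟨rfl, rfl⟩⟩, fun w hw => ?_⟩
      obtain ⟨j, ⟨h, rfl⟩ | ⟨h, rfl⟩⟩ := (hM _ _).1 hw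
      · exact absurd h.symm (hne _ _)
      · rw [hyinj h]
  have hind : M.IsInduced := fun u hu v hv h => ⟨hu, hv, h⟩
  have hedge : M.edgeSet = Set.range fun i => s(x i, y i) := by
    ext e
    induction e with
    | _ u v =>
      rw [Subgraph.mem_edgeSet, hM]
      simp only [Set.mem_range, Sym2.eq_iff]
      exact exists_congr fun i => by tauto
  have hcard : M.edgeSet.ncard = k := by
    rw [hedge, ← Set.image_univ, Set.ncard_image_of_injective, Set.ncard_univ, Nat.card_fin]
    intro i j h
    rcases Sym2.eq_iff.1 h with ⟨h, -⟩ | ⟨h, -⟩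
    · exact hxinj h
    · exact absurd h (hne _ _)
  refine le_csSup ⟨(Set.univ : Set (Sym2 V)).ncard, ?_⟩ ⟨M, hmatch, hind, hcard⟩
  rintro n ⟨M', -, -, rfl⟩
  exact Set.ncard_le_ncard (Set.subset_univ _)

lemma cutMim_comm {V : Type*} (G : SimpleGraph V) (A B : Set V) :
    G.cutMim A B = G.cutMim B A := by
  unfold cutMim
  rw [between_comm]

/-- If the vertices of `S` fall into `k` classes, and vertices of the same class have the same
neighbours outside `S`, then two edges of an induced matching of the cut never start in the same
class. -/
lemma cutMim_compl_le {V : Type*} {G : SimpleGraph V} {S : Set V} {k : ℕ} (lab : V → Fin k)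
    (hlab : ∀ u ∈ S, ∀ u' ∈ S, lab u = lab u' → ∀ w ∉ S, G.Adj u w → G.Adj u' w) :
    G.cutMim S Sᶜ ≤ k := by
  refine csSup_le' ?_
  rintro n ⟨M, hM, hind, rfl⟩
  have hends : ∀ e : M.edgeSet, ∃ u w, e.1 = s(u, w) ∧ M.Adj u w ∧ u ∈ S ∧ w ∉ S := by
    rintro ⟨e, he⟩
    induction e with
    | _ u w =>
      rw [Subgraph.mem_edgeSet] at he
      rcases (between_adj.1 he.adj_sub).2 with ⟨hu, hw⟩ | ⟨hu, hw⟩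
      · exact ⟨u, w, rfl, he, hu, hw⟩
      · exact ⟨w, u, Sym2.eq_swap, he.symm, hw, hu⟩
  choose u w he hadj hu hw using hends
  have hinj : Function.Injective fun e : M.edgeSet => lab (u e) := by
    intro e e' h
    have hcross : (G.between S Sᶜ).Adj (u e') (w e) :=
      between_adj.2 ⟨hlab _ (hu e) _ (hu e') h _ (hw e) (between_adj.1 (hadj e).adj_sub).1,
        Or.inl ⟨hu e', hw e⟩⟩
    have hcross : M.Adj (u e') (w e) :=
      hind (M.edge_vert (hadj e')) (M.edge_vert (hadj e).symm) hcross
    have h1 : w e = w e' := (hM (M.edge_vert (hadj e'))).unique hcross (hadj e')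
    have h2 : u e = u e' :=
      (hM (M.edge_vert (hadj e).symm)).unique (hadj e).symm hcross.symm
    exact Subtype.ext (by rw [he, he, h1, h2])
  have := Nat.card_le_card_of_injective _ hinj
  rwa [Nat.card_fin, Nat.card_coe_set_eq] at this

/-! ### Branch decompositions from codes -/

lemma Reachable.mem_of_adj_closed {V : Type*} {G : SimpleGraph V} {a b : V}
    (h : G.Reachable a b) {S : Set V} (ha : a ∈ S)
    (hS : ∀ u ∈ S, ∀ w, G.Adj u w → w ∈ S) : b ∈ S := by
  obtain ⟨p⟩ := h
  induction p with
  | nil => exact ha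
  | cons hadj _ ih => exact ih (hS _ ha _ hadj)

/-- A binary tree with leaves labelled by `V`, in which each inner node has exactly two children:
`code v` is the route from the leaf `v` up to the root, so that `l` is a node on this route exactly
if it is a suffix of `code v`, and the children of a node `l` are `true :: l` and `false :: l`. -/
structure LeafCode (V : Type*) where
  /-- The route from a leaf up to the root. -/
  code : V → List Bool
  eq_of_suffix : ∀ u v, code u <:+ code v → u = v
  exists_sibling : ∀ l b v, (b :: l) <:+ code v → ∃ u, ((!b) :: l) <:+ code u

namespace LeafCode

variable {V : Type*} (c : LeafCode V)

/-- The nodes of the binary tree: the suffixes of the codes. -/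
abbrev Node : Type _ := {l : List Bool // ∃ v, l <:+ c.code v}

/-- The binary tree of a code as a graph: each node is adjacent to its children. -/
def tree : SimpleGraph c.Node where
  Adj x y := (∃ b, y.1 = b :: x.1) ∨ (∃ b, x.1 = b :: y.1)
  symm := ⟨fun _ _ h => h.symm⟩
  loopless := ⟨fun x h => by
    rcases h with ⟨b, h⟩ | ⟨b, h⟩ <;> simpa using congrArg List.length h⟩

lemma finite_node [Finite V] : Finite c.Node := by
  have h : {l : List Bool | ∃ v, l <:+ c.code v} = ⋃ v, {l | l ∈ (c.code v).tails} := by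
    ext l
    simp
  have : {l : List Bool | ∃ v, l <:+ c.code v}.Finite := by
    rw [h]
    exact Set.finite_iUnion fun v => List.finite_toSet _
  exact this.to_subtype

/-- Deleting the edge above the node `y` separates the nodes below `y` from all others. -/
lemma reachable_deleteEdges_iff {x y : c.Node} {b : Bool} (hy : y.1 = b :: x.1) (z : c.Node) :
    (c.tree.deleteEdges {s(y, x)}).Reachable y z ↔ y.1 <:+ z.1 := by
  constructor
  · intro h
    refine h.mem_of_adj_closed (S := {z : c.Node | y.1 <:+ z.1}) (List.suffix_refl _) ?_
    rintro u hu w hw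
    obtain ⟨hadj, hne⟩ := deleteEdges_adj.1 hw
    rcases hadj with ⟨b', hb'⟩ | ⟨b', hb'⟩
    · show y.1 <:+ w.1
      rw [hb']
      exact List.IsSuffix.trans hu (List.suffix_cons _ _)
    · have hu' : y.1 <:+ u.1 := hu
      rw [hb', List.suffix_cons_iff, ← hb'] at hu'
      rcases hu' with h | h
      · have h1 : y = u := Subtype.ext h
        have h2 : x = w := by
          rw [hb', hy] at h
          exact Subtype.ext (List.cons.inj h).2
        exact absurd (by rw [h1, h2]; rfl) hne
      · exact h
  · obtain ⟨z, hz⟩ := z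
    rintro ⟨m, hm⟩
    replace hm : m ++ y.1 = z := hm
    induction m generalizing z with
    | nil =>
      have : y = ⟨z, hz⟩ := Subtype.ext hm
      rw [this]
    | cons b' m ih =>
      have hsuf : m ++ y.1 <:+ z := by
        rw [← hm]
        exact List.suffix_cons _ _
      have hz' : ∃ v, m ++ y.1 <:+ c.code v := hz.imp fun v hv => hsuf.trans hv
      refine (ih _ hz' rfl).trans (Adj.reachable ?_)
      refine deleteEdges_adj.2 ⟨Or.inl ⟨b', hm.symm⟩, ?_⟩
      intro h
      have h := Sym2.eq_iff.1 (Set.mem_singleton_iff.1 h)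
      have hlen := congrArg List.length hy
      have hlen' := congrArg List.length hm
      simp only [List.length_cons, List.length_append, List.cons_append] at hlen hlen'
      -- the two ends of the deleted edge are too short for the step from `m ++ y` to `z`
      rcases h with ⟨h1, h2⟩ | ⟨h1, h2⟩
      · have := congrArg (List.length ∘ Subtype.val) h2
        simp only [Function.comp] at this
        omega
      · have := congrArg (List.length ∘ Subtype.val) h1
        simp only [Function.comp, List.length_append] at this
        omega

lemma isTree_tree [Nonempty V] : c.tree.IsTree := by
  obtain ⟨v₀⟩ := ‹Nonempty V›
  let root : c.Node := ⟨[], v₀, List.nil_suffix⟩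
  have hroot : ∀ l (h : ∃ v, l <:+ c.code v), c.tree.Reachable root ⟨l, h⟩ := by
    intro l
    induction l with
    | nil => exact fun h => Reachable.refl _
    | cons b l ih =>
      intro h
      exact (ih (h.imp fun v hv => (List.suffix_cons _ _).trans hv)).trans
        (Adj.reachable (Or.inl ⟨b, rfl⟩))
  have hbridge : ∀ (x y : c.Node) (b : Bool), y.1 = b :: x.1 → c.tree.IsBridge s(y, x) := by
    intro x y b hy
    rw [isBridge_iff, c.reachable_deleteEdges_iff hy]
    intro h
    have := h.length_le
    rw [hy, List.length_cons] at this
    omega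
  have : Nonempty c.Node := ⟨root⟩
  refine ⟨⟨fun x y => (hroot x.1 x.2).symm.trans (hroot y.1 y.2)⟩, ?_⟩
  refine isAcyclic_iff_forall_adj_isBridge.2 ?_
  rintro x y (⟨b, h⟩ | ⟨b, h⟩)
  · rw [Sym2.eq_swap]
    exact hbridge _ _ _ h
  · exact hbridge _ _ _ h

lemma ncard_neighborSet_le (x : c.Node) : (c.tree.neighborSet x).ncard ≤ 3 := by
  rw [← Set.ncard_image_of_injective _ Subtype.val_injective]
  calc _ ≤ ({true :: x.1, false :: x.1, x.1.tail} : Set (List Bool)).ncard := by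
        refine Set.ncard_le_ncard ?_ (Set.toFinite _)
        rintro _ ⟨y, ⟨b, h⟩ | ⟨b, h⟩, rfl⟩
        · cases b <;> simp [h]
        · simp [h]
    _ ≤ 3 := by
        refine (Set.ncard_insert_le _ _).trans ?_
        have := Set.ncard_insert_le (false :: x.1) {x.1.tail}
        rw [Set.ncard_singleton] at this
        omega

lemma ncard_neighborSet_le_one_iff [Finite V] (x : c.Node) :
    (c.tree.neighborSet x).ncard ≤ 1 ↔ ∃ v, x.1 = c.code v := by
  have := c.finite_node
  constructor
  · intro hx
    obtain ⟨v, m, hm⟩ := x.2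
    rcases List.eq_nil_or_concat m with rfl | ⟨m, b, rfl⟩
    · exact ⟨v, hm⟩
    · exfalso
      have h1 : b :: x.1 <:+ c.code v := ⟨m, by rw [← hm]; simp⟩
      obtain ⟨u, h2⟩ := c.exists_sibling _ _ _ h1
      have h := (Set.ncard_le_one (Set.toFinite _)).1 hx ⟨_, v, h1⟩ (Or.inl ⟨b, rfl⟩)
        ⟨_, u, h2⟩ (Or.inl ⟨!b, rfl⟩)
      have := congrArg Subtype.val h
      simp at this
  · rintro ⟨v, hv⟩
    refine (Set.ncard_le_one (Set.toFinite _)).2 ?_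
    have hup : ∀ y ∈ c.tree.neighborSet x, ∃ b, x.1 = b :: y.1 := by
      rintro y (⟨b, hb⟩ | h)
      · obtain ⟨u, hu⟩ := y.2
        rw [hb, hv] at hu
        obtain rfl := c.eq_of_suffix _ _ ((List.suffix_cons _ _).trans hu)
        have := hu.length_le
        simp at this
      · exact h
    intro y hy z hz
    obtain ⟨b, hb⟩ := hup y hy
    obtain ⟨b', hb'⟩ := hup z hz
    rw [hb] at hb'
    exact Subtype.ext (List.cons.inj hb').2

/-- The binary tree of a code as a branch decomposition. -/
noncomputable def toBranchDecomposition [Finite V] [Nonempty V] : BranchDecomposition V where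
  Node := c.Node
  finite_node := c.finite_node
  tree := c.tree
  isTree := c.isTree_tree
  subcubic := c.ncard_neighborSet_le
  δ := Equiv.ofBijective
    (fun v => ⟨⟨c.code v, v, List.suffix_refl _⟩, (c.ncard_neighborSet_le_one_iff _).2 ⟨v, rfl⟩⟩)
    ⟨fun u v h => c.eq_of_suffix _ _ (by
        rw [show c.code u = c.code v from congrArg (fun z => z.1.1) h]),
      fun ⟨x, hx⟩ => by
        obtain ⟨v, hv⟩ := (c.ncard_neighborSet_le_one_iff x).1 hx
        exact ⟨v, Subtype.ext (Subtype.ext hv.symm)⟩⟩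

end LeafCode

/-! ### Cuts at the edges of a tree -/

/-- Deleting an edge of a tree leaves exactly two components. -/
lemma IsTree.reachable_deleteEdges_swap_iff {N : Type*} {T : SimpleGraph N} (hT : T.IsTree)
    {x y : N} (h : T.Adj x y) (w : N) :
    (T.deleteEdges {s(y, x)}).Reachable y w ↔ ¬ (T.deleteEdges {s(x, y)}).Reachable x w := by
  rw [Sym2.eq_swap]
  have hb := isBridge_iff.1 (isAcyclic_iff_forall_adj_isBridge.1 hT.isAcyclic h)
  refine ⟨fun hy hx => hb (hx.trans hy.symm), fun hx => ?_⟩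
  have := (hT.connected.preconnected x w).mem_of_adj_closed
    (S := {w | (T.deleteEdges {s(x, y)}).Reachable x w ∨
      (T.deleteEdges {s(x, y)}).Reachable y w}) (Or.inl (Reachable.refl _)) ?_
  · exact this.resolve_left hx
  · intro u hu v huv
    by_cases he : s(u, v) = s(x, y)
    · rcases Sym2.eq_iff.1 he with ⟨-, rfl⟩ | ⟨-, rfl⟩
      · exact Or.inr (Reachable.refl _)
      · exact Or.inl (Reachable.refl _)
    · have huv' : (T.deleteEdges {s(x, y)}).Adj u v := deleteEdges_adj.2 ⟨huv, he⟩
      exact hu.imp (fun h => h.trans huv'.reachable) fun h => h.trans huv'.reachable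

lemma BranchDecomposition.side_swap {V : Type*} (D : BranchDecomposition V) {x y : D.Node}
    (h : D.tree.Adj x y) : D.side y x = (D.side x y)ᶜ := by
  ext v
  exact D.isTree.reachable_deleteEdges_swap_iff h _

lemma LeafCode.mimWidth_toBranchDecomposition_le {V : Type*} [Finite V] [Nonempty V]
    (c : LeafCode V) {G : SimpleGraph V} {k : ℕ}
    (h : ∀ l, G.cutMim {v | l <:+ c.code v} {v | l <:+ c.code v}ᶜ ≤ k) :
    c.toBranchDecomposition.mimWidth G ≤ k := by
  have hside : ∀ (x y : c.Node) (b : Bool), y.1 = b :: x.1 →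
      c.toBranchDecomposition.side y x = {v | y.1 <:+ c.code v} := by
    intro x y b hy
    ext v
    exact c.reachable_deleteEdges_iff hy _
  refine ciSup_le' fun d => ?_
  rcases id d.adj with ⟨b, hb⟩ | ⟨b, hb⟩
  · rw [c.toBranchDecomposition.side_swap d.adj.symm, compl_compl, cutMim_comm, hside _ _ b hb]
    exact h _
  · rw [hside _ _ b hb]
    exact h _

/-- A subcubic tree has an edge such that, of `3 * m` given leaves, at least `m` lie on either
side. Otherwise each edge has a side with more than `2 * m` of them; at the inner end of such a
side, taken as small as possible, at most two further branches meet, each with fewer than `m`. -/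
lemma IsTree.exists_balanced_edge {N : Type*} [Finite N] {T : SimpleGraph N} (hT : T.IsTree)
    (hdeg : ∀ x, (T.neighborSet x).ncard ≤ 3) {m : ℕ} (hm : 0 < m) (f : Fin (3 * m) → N)
    (hf : Function.Injective f) (hleaf : ∀ i, (T.neighborSet (f i)).ncard ≤ 1) :
    ∃ x y, T.Adj x y ∧ m ≤ {i | (T.deleteEdges {s(x, y)}).Reachable x (f i)}.ncard ∧
      m ≤ {i | ¬ (T.deleteEdges {s(x, y)}).Reachable x (f i)}.ncard := by
  classical
  let comp : N → N → Set N := fun x y => {w | (T.deleteEdges {s(x, y)}).Reachable x w}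
  let W : N → N → Finset (Fin (3 * m)) := fun x y => {i | f i ∈ comp x y}
  have hswap : ∀ x y, T.Adj x y → ∀ w, w ∈ comp y x ↔ w ∉ comp x y :=
    fun x y h w => hT.reachable_deleteEdges_swap_iff h w
  have hself : ∀ x y, x ∈ comp x y := fun x y => Reachable.refl _
  have hWcompl : ∀ x y, T.Adj x y → W y x = ({i | ¬ f i ∈ comp x y} : Finset (Fin (3 * m))) :=
    fun x y h => Finset.filter_congr fun i _ => hswap x y h _
  have hWswap : ∀ x y, T.Adj x y → (W x y).card + (W y x).card = 3 * m := by
    intro x y h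
    rw [hWcompl x y h, Finset.card_filter_add_card_filter_not, Finset.card_univ, Fintype.card_fin]
  by_contra hcon
  have hlight : ∀ x y, T.Adj x y → (W x y).card < m ∨ (W y x).card < m := by
    intro x y h
    by_contra! h'
    refine hcon ⟨x, y, h, ?_, ?_⟩
    · rw [Set.ncard_eq_toFinset_card']
      simpa [W, comp] using h'.1
    · have := h'.2
      rw [Set.ncard_eq_toFinset_card']
      rw [hWcompl x y h] at this
      simpa [comp] using this
  have hheavy : ∀ n x y, T.Adj x y → (comp y x).ncard = n → 2 * m < (W y x).card → False := by
    intro n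
    induction n using Nat.strong_induction_on with
    | _ n ih =>
      intro x y hxy hn hW
      have hsub : ∀ z, T.Adj y z → z ≠ x → comp z y ⊆ comp y x := by
        intro z hyz hzx w hw
        have hzy : (T.deleteEdges {s(y, x)}).Adj y z := by
          refine deleteEdges_adj.2 ⟨hyz, fun h => ?_⟩
          rcases Sym2.eq_iff.1 h with ⟨-, h⟩ | ⟨h, -⟩
          · exact hzx h
          · exact hxy.ne h.symm
        refine (Reachable.mem_of_adj_closed (S := comp z y ∩ comp y x) hw
          ⟨hself _ _, hzy.reachable⟩ ?_).2
        rintro u ⟨hu, hu'⟩ v huv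
        have hv : v ∈ comp z y := Reachable.trans hu huv.reachable
        refine ⟨hv, Reachable.trans hu' (Adj.reachable (deleteEdges_adj.2
          ⟨(deleteEdges_adj.1 huv).1, fun h => ?_⟩))⟩
        -- an end `y` of the edge would lie in the component of `z`
        have hy : y ∉ comp z y := fun h => (hswap y z hyz y).1 h (hself y z)
        rcases Sym2.eq_iff.1 h with ⟨rfl, -⟩ | ⟨-, rfl⟩
        · exact hy hu
        · exact hy hv
      have hsmall : ∀ z, T.Adj y z → z ≠ x → (W z y).card < m := by
        intro z hyz hzx
        refine (hlight z y hyz.symm).resolve_right fun h => ?_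
        have := hWswap y z hyz
        refine ih _ ?_ y z hyz rfl (by omega)
        rw [← hn]
        refine Set.ncard_lt_ncard ⟨hsub z hyz hzx, fun h => ?_⟩ (Set.toFinite _)
        exact (hswap y z hyz y).1 (h (hself y x)) (hself y z)
      have hcover : ∀ w ∈ comp y x, w = y ∨ ∃ z, T.Adj y z ∧ z ≠ x ∧ w ∈ comp z y := by
        intro w hw
        refine Reachable.mem_of_adj_closed
          (S := {w | w = y ∨ ∃ z, T.Adj y z ∧ z ≠ x ∧ w ∈ comp z y}) hw (Or.inl rfl) ?_
        intro u hu v huv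
        obtain ⟨hadj, hne⟩ := deleteEdges_adj.1 huv
        rcases hu with rfl | ⟨z, hyz, hzx, hu⟩
        · refine Or.inr ⟨v, hadj, ?_, hself _ _⟩
          rintro rfl
          exact hne rfl
        · by_cases h : s(u, v) = s(z, y)
          · rcases Sym2.eq_iff.1 h with ⟨-, h⟩ | ⟨-, rfl⟩
            · exact Or.inl h
            · exact Or.inr ⟨v, hyz, hzx, hself _ _⟩
          · exact Or.inr ⟨z, hyz, hzx, Reachable.trans hu
              (Adj.reachable (deleteEdges_adj.2 ⟨hadj, h⟩))⟩
      have hxmem : x ∈ T.neighborSet y := hxy.symm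
      by_cases hy : (T.neighborSet y).ncard ≤ 1
      · have : (W y x).card ≤ 1 := by
          refine Finset.card_le_one.2 fun i hi j hj => hf ?_
          have hall : ∀ i ∈ W y x, f i = y := by
            intro i hi
            refine (hcover _ (Finset.mem_filter.1 hi).2).resolve_right ?_
            rintro ⟨z, hyz, hzx, -⟩
            exact hzx ((Set.ncard_le_one (Set.toFinite _)).1 hy z hyz x hxmem)
          rw [hall i hi, hall j hj]
        omega
      · have hcov : W y x ⊆ (Set.toFinite (T.neighborSet y \ {x})).toFinset.biUnion
            fun z => W z y := by
          intro i hi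
          rcases hcover _ (Finset.mem_filter.1 hi).2 with h | ⟨z, hyz, hzx, hz⟩
          · exact absurd (h ▸ hleaf i) hy
          · refine Finset.mem_biUnion.2 ⟨z, ?_, Finset.mem_filter.2 ⟨Finset.mem_univ _, hz⟩⟩
            simp [hyz, hzx]
        have h1 := (Finset.card_le_card hcov).trans
          (Finset.card_biUnion_le_card_mul _ _ m fun z hz => by
            have : T.Adj y z ∧ z ≠ x := by simpa using hz
            exact (hsmall z this.1 this.2).le)
        rw [← Set.ncard_eq_toFinset_card, Set.ncard_sdiff_singleton_of_mem hxmem] at h1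
        have h2 : (T.neighborSet y).ncard - 1 ≤ 2 := by
          have := hdeg y
          omega
        have h3 := Nat.mul_le_mul_right m h2
        omega
  have hedge : ∃ x y, T.Adj x y := by
    by_contra! h
    have := (hT.connected.preconnected (f ⟨0, by omega⟩) (f ⟨1, by omega⟩)).mem_of_adj_closed
      (S := {f ⟨0, by omega⟩}) rfl fun u _ w huw => absurd huw (h u w)
    have := hf (Set.mem_singleton_iff.1 this)
    simp at this
  obtain ⟨x, y, hxy⟩ := hedge
  have := hWswap x y hxy
  rcases hlight x y hxy with h | h
  · exact hheavy _ x y hxy rfl (by omega)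
  · exact hheavy _ y x hxy.symm rfl (by omega)

/-! ### Mim-width is at most clique-width -/

lemma append_singleton_suffix_iff {α : Type*} {l l' : List α} {a b : α} :
    l ++ [a] <:+ l' ++ [b] ↔ a = b ∧ l <:+ l' := by
  rw [List.suffix_concat_iff]
  simp only [List.append_eq_nil_iff, List.cons_ne_nil, and_false, false_or]
  constructor
  · rintro ⟨t, h, ht⟩
    obtain ⟨rfl, h⟩ := List.append_inj' h rfl
    exact ⟨by simpa using h, ht⟩
  · rintro ⟨rfl, h⟩
    exact ⟨l, rfl, h⟩

namespace LeafCode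

/-- The binary tree with two given binary trees below its root. -/
def sum {V W : Type*} [Nonempty V] [Nonempty W] (c : LeafCode V) (d : LeafCode W) :
    LeafCode (V ⊕ W) where
  code := Sum.elim (fun v => c.code v ++ [true]) (fun w => d.code w ++ [false])
  eq_of_suffix := by
    rintro (u | u) (v | v) <;>
      simp only [Sum.elim_inl, Sum.elim_inr, append_singleton_suffix_iff] <;> rintro ⟨h, h'⟩
    · rw [c.eq_of_suffix _ _ h']
    · simp at h
    · simp at h
    · rw [d.eq_of_suffix _ _ h']
  exists_sibling := by
    intro l b v h
    obtain ⟨v₀⟩ := ‹Nonempty V›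
    obtain ⟨w₀⟩ := ‹Nonempty W›
    rcases List.eq_nil_or_concat' l with rfl | ⟨l, b', rfl⟩
    · cases b
      · exact ⟨Sum.inl v₀, c.code v₀, rfl⟩
      · exact ⟨Sum.inr w₀, d.code w₀, rfl⟩
    · rw [← List.cons_append] at h ⊢
      rcases v with v | v
      · obtain ⟨rfl, hl⟩ := append_singleton_suffix_iff.1 h
        obtain ⟨u, hu⟩ := c.exists_sibling _ _ _ hl
        exact ⟨Sum.inl u, append_singleton_suffix_iff.2 ⟨rfl, hu⟩⟩
      · obtain ⟨rfl, hl⟩ := append_singleton_suffix_iff.1 h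
        obtain ⟨u, hu⟩ := d.exists_sibling _ _ _ hl
        exact ⟨Sum.inr u, append_singleton_suffix_iff.2 ⟨rfl, hu⟩⟩

lemma suffix_sum_inl {V W : Type*} [Nonempty V] [Nonempty W] {c : LeafCode V} {d : LeafCode W}
    {l : List Bool} {b : Bool} {v : V} :
    l ++ [b] <:+ (c.sum d).code (Sum.inl v) ↔ b = true ∧ l <:+ c.code v :=
  append_singleton_suffix_iff

lemma suffix_sum_inr {V W : Type*} [Nonempty V] [Nonempty W] {c : LeafCode V} {d : LeafCode W}
    {l : List Bool} {b : Bool} {w : W} :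
    l ++ [b] <:+ (c.sum d).code (Sum.inr w) ↔ b = false ∧ l <:+ d.code w :=
  append_singleton_suffix_iff

/-- Relabelling the leaves of a binary tree. -/
def comapEquiv {V W : Type*} (c : LeafCode W) (e : V ≃ W) : LeafCode V where
  code v := c.code (e v)
  eq_of_suffix u v h := e.injective (c.eq_of_suffix _ _ h)
  exists_sibling l b v h := by
    obtain ⟨u, hu⟩ := c.exists_sibling l b _ h
    exact ⟨e.symm u, by rwa [e.apply_symm_apply]⟩

end LeafCode

namespace CliqueExpr

instance nonempty_vert {k : ℕ} : (t : CliqueExpr k) → Nonempty t.Vert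
  | vertex _ => ⟨()⟩
  | union s _ => (nonempty_vert s).map Sum.inl
  | join _ _ _ t => nonempty_vert t
  | relabel _ _ t => nonempty_vert t

lemma not_union_adj_inl_inr {k : ℕ} {s t : CliqueExpr k} {x : s.Vert} {y : t.Vert} :
    ¬ (union s t).graph.Adj (Sum.inl x) (Sum.inr y) :=
  not_adj_sum_inl_inr _ _

/-- The syntax tree of a term with `k` labels gives a binary tree. Vertices which have the same
label in the graph built by a subterm get the same label, and the same neighbours outside that
subterm, in the graph built by the whole term. -/
lemma exists_leafCode {k : ℕ} (t : CliqueExpr k) :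
    ∃ c : LeafCode t.Vert, ∀ l, ∃ lab : t.Vert → Fin k, ∀ u u',
      l <:+ c.code u → l <:+ c.code u' → lab u = lab u' → t.label u = t.label u' ∧
        ∀ w, ¬ l <:+ c.code w → t.graph.Adj u w → t.graph.Adj u' w := by
  induction t with
  | vertex i =>
    refine ⟨⟨fun _ => [], fun _ _ _ => rfl, fun l b v h => by simp at h⟩, fun l => ?_⟩
    refine ⟨fun _ => i, fun u u' _ _ _ => ⟨rfl, fun w _ h => h.elim⟩⟩
  | union s t ihs iht =>
    obtain ⟨c, hc⟩ := ihs
    obtain ⟨d, hd⟩ := iht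
    refine ⟨c.sum d, fun l => ?_⟩
    rcases List.eq_nil_or_concat' l with rfl | ⟨l, b, rfl⟩
    · exact ⟨(union s t).label, fun u u' _ _ h => ⟨h, fun w hw => absurd List.nil_suffix hw⟩⟩
    · cases b
      · obtain ⟨lab, hlab⟩ := hd l
        refine ⟨Sum.elim s.label lab, ?_⟩
        rintro (u | u) (u' | u') hu hu' h <;>
          simp only [LeafCode.suffix_sum_inl, LeafCode.suffix_sum_inr, Bool.false_eq_true,
            false_and, true_and] at hu hu'
        obtain ⟨h1, h2⟩ := hlab u u' hu hu' h
        refine ⟨h1, ?_⟩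
        rintro (w | w) hw hadj
        · exact (not_union_adj_inl_inr hadj.symm).elim
        · exact h2 w (fun h => hw (LeafCode.suffix_sum_inr.2 ⟨rfl, h⟩)) hadj
      · obtain ⟨lab, hlab⟩ := hc l
        refine ⟨Sum.elim lab t.label, ?_⟩
        rintro (u | u) (u' | u') hu hu' h <;>
          simp only [LeafCode.suffix_sum_inl, LeafCode.suffix_sum_inr, Bool.true_eq_false,
            false_and, true_and] at hu hu'
        obtain ⟨h1, h2⟩ := hlab u u' hu hu' h
        refine ⟨h1, ?_⟩
        rintro (w | w) hw hadj
        · exact h2 w (fun h => hw (LeafCode.suffix_sum_inl.2 ⟨rfl, h⟩)) hadj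
        · exact (not_union_adj_inl_inr hadj).elim
  | join i j hij t ih =>
    obtain ⟨c, hc⟩ := ih
    refine ⟨c, fun l => ?_⟩
    obtain ⟨lab, hlab⟩ := hc l
    refine ⟨lab, fun u u' hu hu' h => ?_⟩
    obtain ⟨h1, h2⟩ := hlab u u' hu hu' h
    refine ⟨h1, fun w hw hadj => ?_⟩
    rcases hadj with hadj | ⟨-, hadj⟩
    · exact Or.inl (h2 w hw hadj)
    · refine Or.inr ⟨fun h => hw (h ▸ hu'), ?_⟩
      exact hadj.imp (fun h => ⟨h1.symm.trans h.1, h.2⟩) fun h => ⟨h.1, h1.symm.trans h.2⟩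
  | relabel i j t ih =>
    obtain ⟨c, hc⟩ := ih
    refine ⟨c, fun l => ?_⟩
    obtain ⟨lab, hlab⟩ := hc l
    refine ⟨lab, fun u u' hu hu' h => ?_⟩
    obtain ⟨h1, h2⟩ := hlab u u' hu hu' h
    refine ⟨?_, h2⟩
    show (if t.label u = i then j else t.label u) = if t.label u' = i then j else t.label u'
    rw [h1]

/-- Every set of vertices is built without edges by a term that gives all of them distinct
labels. -/
lemma exists_edgeless {V : Type*} {n : ℕ} (e : V → Fin n) (A : Finset V) (hA : A.Nonempty) :
    ∃ (t : CliqueExpr n) (f : t.Vert → V), Function.Injective f ∧ Set.range f = A ∧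
      (∀ x, t.label x = e (f x)) ∧ ∀ x y, ¬ t.graph.Adj x y := by
  induction hA using Finset.Nonempty.cons_induction with
  | singleton a =>
    refine ⟨vertex (e a), fun _ => a, fun _ _ _ => rfl, ?_, fun _ => rfl, fun _ _ h => h⟩
    simp only [Finset.coe_singleton]
    exact Set.range_const (ι := Unit)
  | cons a s ha hs ih =>
    obtain ⟨t, f, hf, hr, hlab, hadj⟩ := ih
    have haf : ∀ x, f x ≠ a := by
      rintro x rfl
      exact ha (Finset.mem_coe.1 (hr ▸ Set.mem_range_self x))
    refine ⟨union (vertex (e a)) t, Sum.elim (fun _ => a) f, ?_, ?_, ?_, ?_⟩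
    · exact Function.Injective.sumElim (fun _ _ _ => rfl) hf fun _ x => (haf x).symm
    · rw [Finset.coe_cons, ← hr]
      refine (Set.Sum.elim_range _ _).trans ?_
      rw [← Set.singleton_union]
      exact congrArg (· ∪ _) (Set.range_const (ι := Unit))
    · rintro (x | x)
      · rfl
      · exact hlab x
    · rintro (x | x) (y | y) h
      · exact h
      · exact not_union_adj_inl_inr h
      · exact not_union_adj_inl_inr h.symm
      · exact hadj x y h

/-- Every finite graph with at least one vertex is built by some term: with distinct labels, the
edges can be added one at a time. -/
lemma exists_iso {V : Type*} [Finite V] [Nonempty V] (G : SimpleGraph V) :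
    ∃ (k : ℕ) (t : CliqueExpr k), Nonempty (G ≃g t.graph) := by
  classical
  obtain ⟨n, ⟨e⟩⟩ := Finite.exists_equiv_fin V
  have hlist : ∀ L : List (Fin n × Fin n), ∃ (t : CliqueExpr n) (f : t.Vert → V),
      Function.Bijective f ∧ (∀ x, t.label x = e (f x)) ∧ ∀ x y, t.graph.Adj x y ↔
        x ≠ y ∧ ∃ p ∈ L, (e (f x) = p.1 ∧ e (f y) = p.2) ∨ (e (f y) = p.1 ∧ e (f x) = p.2) := by
    intro L
    induction L with
    | nil =>
      have := Fintype.ofFinite V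
      obtain ⟨t, f, hf, hr, hlab, hadj⟩ := exists_edgeless e Finset.univ Finset.univ_nonempty
      refine ⟨t, f, ⟨hf, Set.range_eq_univ.1 (by simpa using hr)⟩, hlab, fun x y => ?_⟩
      simp [hadj]
    | cons p L ih =>
      obtain ⟨t, f, hf, hlab, hadj⟩ := ih
      by_cases hp : p.1 = p.2
      · refine ⟨t, f, hf, hlab, fun x y => ?_⟩
        rw [hadj]
        refine and_congr_right fun hxy => ?_
        have : e (f x) ≠ e (f y) := fun h => hxy (hf.1 (e.injective h))
        simp only [List.mem_cons, exists_eq_or_imp]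
        grind
      · refine ⟨join p.1 p.2 hp t, f, hf, hlab, fun x y => ?_⟩
        have h1 : (join p.1 p.2 hp t).graph.Adj x y ↔ t.graph.Adj x y ∨ (x ≠ y ∧
          ((t.label x = p.1 ∧ t.label y = p.2) ∨ (t.label y = p.1 ∧ t.label x = p.2))) := Iff.rfl
        refine h1.trans ?_
        rw [hadj x y, hlab x, hlab y]
        simp only [List.mem_cons, exists_eq_or_imp]
        exact and_or_left.symm.trans (and_congr_right fun _ => or_comm)
  obtain ⟨t, f, hf, -, hadj⟩ := hlist
    (Finset.univ.filter fun p : Fin n × Fin n => G.Adj (e.symm p.1) (e.symm p.2)).toList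
  refine ⟨n, t, ⟨(⟨Equiv.ofBijective f hf, ?_⟩ : t.graph ≃g G).symm⟩⟩
  intro x y
  rw [hadj]
  simp only [Finset.mem_toList, Finset.mem_filter, Finset.mem_univ, true_and, Prod.exists,
    Equiv.ofBijective_apply]
  constructor
  · exact fun h => ⟨fun hxy => h.ne (congrArg f hxy), _, _, by simpa using h, Or.inl ⟨rfl, rfl⟩⟩
  · rintro ⟨-, i, j, h, ⟨rfl, rfl⟩ | ⟨rfl, rfl⟩⟩
    · simpa using h
    · simpa using h.symm

end CliqueExpr

lemma nonempty_branchDecomposition (V : Type*) [Finite V] [Nonempty V] :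
    Nonempty (BranchDecomposition V) := by
  obtain ⟨k, t, ⟨φ⟩⟩ := CliqueExpr.exists_iso (⊥ : SimpleGraph V)
  obtain ⟨c, -⟩ := t.exists_leafCode
  exact ⟨(c.comapEquiv φ.toEquiv).toBranchDecomposition⟩

lemma mimWidth_le_of_iso {V : Type*} [Finite V] [Nonempty V] {G : SimpleGraph V} {k : ℕ}
    (t : CliqueExpr k) (φ : G ≃g t.graph) : G.mimWidth ≤ k := by
  obtain ⟨c, hc⟩ := t.exists_leafCode
  refine le_trans (Nat.sInf_le ⟨(c.comapEquiv φ.toEquiv).toBranchDecomposition, rfl⟩)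
    ((c.comapEquiv φ.toEquiv).mimWidth_toBranchDecomposition_le fun l => ?_)
  obtain ⟨lab, hlab⟩ := hc l
  refine cutMim_compl_le (fun v => lab (φ v)) fun u hu u' hu' h w hw hadj => ?_
  exact φ.map_adj_iff.1 ((hlab _ _ hu hu' h).2 _ hw (φ.map_adj_iff.2 hadj))

lemma mimWidth_eq_zero_of_isEmpty {V : Type*} [IsEmpty V] (G : SimpleGraph V) :
    G.mimWidth = 0 := by
  by_cases h : Nonempty (BranchDecomposition V)
  · obtain ⟨D⟩ := h
    refine Nat.le_zero.1 (le_trans (Nat.sInf_le ⟨D, rfl⟩) (ciSup_le' fun d => ?_))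
    exact cutMim_compl_le isEmptyElim fun u => isEmptyElim u
  · have : {k : ℕ | ∃ D : BranchDecomposition V, D.mimWidth G = k} = ∅ :=
      Set.eq_empty_of_forall_notMem fun k ⟨D, _⟩ => h ⟨D⟩
    rw [mimWidth, this, Nat.sInf_empty]

theorem mimWidth_le_cliqueWidth {V : Type*} [Finite V] (G : SimpleGraph V) :
    G.mimWidth ≤ G.cliqueWidth := by
  rcases isEmpty_or_nonempty V with hV | hV
  · rw [mimWidth_eq_zero_of_isEmpty]
    exact Nat.zero_le _
  · obtain ⟨t, ⟨φ⟩⟩ := Nat.sInf_mem (s := {k | ∃ t : CliqueExpr k, Nonempty (G ≃g t.graph)})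
      (CliqueExpr.exists_iso G)
    exact mimWidth_le_of_iso t φ

/-! ### Graphs without an induced path on four vertices -/

/-- No four vertices induce a path on four vertices. That they are distinct follows from the
adjacencies. -/
def IsP4Free {V : Type*} (G : SimpleGraph V) : Prop :=
  ∀ a b c d, G.Adj a b → G.Adj b c → G.Adj c d → ¬ G.Adj a c → ¬ G.Adj a d → G.Adj b d

lemma isP4Free_of_not_isIndContained {V : Type*} {G : SimpleGraph V}
    (h : ¬ (pathGraph 4).IsIndContained G) : G.IsP4Free := by
  intro a b c d hab hbc hcd hac had
  by_contra hbd
  have hne : a ≠ b ∧ a ≠ c ∧ a ≠ d ∧ b ≠ c ∧ b ≠ d ∧ c ≠ d := by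
    refine ⟨hab.ne, ?_, ?_, hbc.ne, ?_, hcd.ne⟩ <;> rintro rfl
    · exact had hcd
    · exact hac hcd.symm
    · exact had hab
  obtain ⟨h1, h2, h3, h4, h5, h6⟩ := hne
  refine h ⟨⟨⟨![a, b, c, d], ?_⟩, ?_⟩⟩
  · intro i j hij
    fin_cases i <;> fin_cases j <;> simp_all
  · intro i j
    show G.Adj (![a, b, c, d] i) (![a, b, c, d] j) ↔ (pathGraph 4).Adj i j
    fin_cases i <;> fin_cases j <;>
      simp [pathGraph_adj, hab, hbc, hcd, hab.symm, hbc.symm, hcd.symm, hac, had, hbd,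
        G.adj_comm c a, G.adj_comm d a, G.adj_comm d b]

lemma IsP4Free.compl {V : Type*} {G : SimpleGraph V} (h : G.IsP4Free) : Gᶜ.IsP4Free := by
  intro a b c d hab hbc hcd hac had
  simp only [compl_adj] at *
  have := h b d a c
  grind [G.adj_comm]

/-- The vertex set `A` is the union of two disjoint nonempty sets with all edges, or with no edge,
between them. -/
def IsDecomposable {V : Type*} [DecidableEq V] (G : SimpleGraph V) (A : Finset V) : Prop :=
  ∃ S S' : Finset V, S.Nonempty ∧ S'.Nonempty ∧ Disjoint S S' ∧ S ∪ S' = A ∧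
    ((∀ x ∈ S, ∀ y ∈ S', G.Adj x y) ∨ ∀ x ∈ S, ∀ y ∈ S', ¬ G.Adj x y)

lemma IsDecomposable.of_compl {V : Type*} [DecidableEq V] {G : SimpleGraph V} {A : Finset V}
    (h : Gᶜ.IsDecomposable A) : G.IsDecomposable A := by
  obtain ⟨S, S', hS, hS', hd, hA, h⟩ := h
  have hne : ∀ x ∈ S, ∀ y ∈ S', x ≠ y := fun x hx y hy => Finset.disjoint_iff_ne.1 hd x hx y hy
  refine ⟨S, S', hS, hS', hd, hA, h.symm.imp (fun h x hx y hy => ?_) fun h x hx y hy => ?_⟩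
  · by_contra hxy
    exact h x hx y hy ((compl_adj _ _ _).2 ⟨hne x hx y hy, hxy⟩)
  · exact ((compl_adj _ _ _).1 (h x hx y hy)).2

/-- If `v` has a neighbour in `S'` and a non-neighbour in `S`, then an edge `ab` in `S` with `v`
adjacent to `a` only would give an induced path `b a v c`. Hence the non-neighbours of `v` in `S`
split off. -/
lemma IsP4Free.isDecomposable_insert_of_mem {V : Type*} [DecidableEq V] {G : SimpleGraph V}
    (hG : G.IsP4Free) {v : V} {S S' : Finset V} (hd : Disjoint S S') (hv : v ∉ S)
    (hSS : ∀ x ∈ S, ∀ y ∈ S', ¬ G.Adj x y) {b c : V} (hb : b ∈ S) (hvb : ¬ G.Adj v b)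
    (hc : c ∈ S') (hvc : G.Adj v c) : G.IsDecomposable (insert v (S ∪ S')) := by
  classical
  have hno : ∀ a ∈ S, ∀ b ∈ S, G.Adj v a → ¬ G.Adj v b → ¬ G.Adj b a := by
    intro a ha b hb hva hvb hba
    exact hSS a ha c hc (hG b a v c hba hva.symm hvc (fun h => hvb h.symm) (hSS b hb c hc))
  refine ⟨S.filter (fun x => ¬ G.Adj v x), insert v (S.filter (fun x => G.Adj v x) ∪ S'),
    ⟨b, by simp [hb, hvb]⟩, ⟨v, by simp⟩, ?_, ?_, Or.inr ?_⟩
  · rw [Finset.disjoint_left] at hd ⊢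
    intro x hx
    simp only [Finset.mem_filter, Finset.mem_insert, Finset.mem_union] at hx ⊢
    rintro (rfl | h | h)
    · exact hv hx.1
    · exact hx.2 h.2
    · exact hd hx.1 h
  · ext x
    simp only [Finset.mem_filter, Finset.mem_insert, Finset.mem_union]
    tauto
  · intro x hx y hy
    simp only [Finset.mem_filter, Finset.mem_insert, Finset.mem_union] at hx hy
    rcases hy with rfl | hy | hy
    · exact fun h => hx.2 h.symm
    · exact hno y hy.1 x hx.1 hy.2 hx.2
    · exact hSS x hx.1 y hy

lemma IsP4Free.isDecomposable_insert {V : Type*} [DecidableEq V] {G : SimpleGraph V}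
    (hG : G.IsP4Free) {v : V} {S S' : Finset V} (hS : S.Nonempty) (hS' : S'.Nonempty)
    (hd : Disjoint S S') (hv : v ∉ S) (hv' : v ∉ S') (hSS : ∀ x ∈ S, ∀ y ∈ S', ¬ G.Adj x y) :
    G.IsDecomposable (insert v (S ∪ S')) := by
  by_cases h1 : ∃ a ∈ S, G.Adj v a
  swap
  · push Not at h1
    refine ⟨S, insert v S', hS, ⟨v, by simp⟩, Finset.disjoint_insert_right.2 ⟨hv, hd⟩, by simp,
      Or.inr fun x hx y hy => ?_⟩
    rcases Finset.mem_insert.1 hy with rfl | hy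
    · exact fun h => h1 x hx h.symm
    · exact hSS x hx y hy
  by_cases h2 : ∃ a ∈ S', G.Adj v a
  swap
  · push Not at h2
    refine ⟨S', insert v S, hS', ⟨v, by simp⟩, Finset.disjoint_insert_right.2 ⟨hv', hd.symm⟩,
      by rw [Finset.union_insert, Finset.union_comm], Or.inr fun x hx y hy => ?_⟩
    rcases Finset.mem_insert.1 hy with rfl | hy
    · exact fun h => h2 x hx h.symm
    · exact fun h => hSS y hy x hx h.symm
  obtain ⟨a, ha, hva⟩ := h1
  obtain ⟨a', ha', hva'⟩ := h2
  by_cases h3 : ∃ b ∈ S, ¬ G.Adj v b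
  · obtain ⟨b, hb, hvb⟩ := h3
    exact hG.isDecomposable_insert_of_mem hd hv hSS hb hvb ha' hva'
  by_cases h4 : ∃ b ∈ S', ¬ G.Adj v b
  · obtain ⟨b, hb, hvb⟩ := h4
    rw [Finset.union_comm]
    exact hG.isDecomposable_insert_of_mem hd.symm hv' (fun x hx y hy h => hSS y hy x hx h.symm)
      hb hvb ha hva
  push Not at h3 h4
  refine ⟨{v}, S ∪ S', by simp, hS.mono Finset.subset_union_left, by simp [hv, hv'],
    (Finset.insert_eq _ _).symm, Or.inl fun x hx y hy => ?_⟩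
  rw [Finset.mem_singleton.1 hx]
  rcases Finset.mem_union.1 hy with hy | hy
  · exact h3 y hy
  · exact h4 y hy

/-- Induction on `A`: as the complement is `P₄`-free too, the decomposition of `A` without a vertex
may be assumed to be one without edges between the two parts. -/
lemma IsP4Free.isDecomposable {V : Type*} [DecidableEq V] {G : SimpleGraph V}
    (hG : G.IsP4Free) (A : Finset V) (hA : A.Nontrivial) : G.IsDecomposable A := by
  induction A using Finset.induction_on with
  | empty => simp at hA
  | insert v B hv ih =>
    by_cases hB : B.Nontrivial
    · obtain ⟨S, S', hS, hS', hd, rfl, h⟩ := ih hB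
      rw [Finset.mem_union, not_or] at hv
      rcases h with h | h
      · exact (hG.compl.isDecomposable_insert hS hS' hd hv.1 hv.2 fun x hx y hy h' =>
          ((compl_adj _ _ _).1 h').2 (h x hx y hy)).of_compl
      · exact hG.isDecomposable_insert hS hS' hd hv.1 hv.2 h
    · have hne : B.Nonempty := by
        rw [Finset.nonempty_iff_ne_empty]
        rintro rfl
        simp at hA
      obtain ⟨b, rfl⟩ := hne.exists_eq_singleton_or_nontrivial.resolve_right hB
      refine ⟨{v}, {b}, by simp, by simp, by simpa [eq_comm] using hv, rfl, ?_⟩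
      simp only [Finset.mem_singleton, forall_eq]
      exact em _

lemma IsP4Free.exists_cliqueExpr {V : Type*} {G : SimpleGraph V}
    (hG : G.IsP4Free) (A : Finset V) (hA : A.Nonempty) :
    ∃ (t : CliqueExpr 2) (f : t.Vert → V), Function.Injective f ∧ Set.range f = A ∧
      (∀ x, t.label x = 0) ∧ ∀ x y, t.graph.Adj x y ↔ G.Adj (f x) (f y) := by
  classical
  induction A using Finset.strongInduction with
  | H A ih =>
    rcases hA.exists_eq_singleton_or_nontrivial with ⟨a, rfl⟩ | hA'
    · refine ⟨.vertex 0, fun _ => a, fun _ _ _ => rfl, ?_, fun _ => rfl, fun _ _ => ?_⟩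
      · simp only [Finset.coe_singleton]
        exact Set.range_const (ι := Unit)
      · exact iff_of_false id G.irrefl
    · obtain ⟨S, S', hS, hS', hd, rfl, h⟩ := hG.isDecomposable A hA'
      have hlt : S ⊂ S ∪ S' := by
        refine Finset.ssubset_iff_subset_ne.2 ⟨Finset.subset_union_left, fun h => ?_⟩
        obtain ⟨x, hx⟩ := hS'
        exact Finset.disjoint_left.1 hd (h ▸ Finset.mem_union_right _ hx) hx
      have hlt' : S' ⊂ S ∪ S' := by
        refine Finset.ssubset_iff_subset_ne.2 ⟨Finset.subset_union_right, fun h => ?_⟩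
        obtain ⟨x, hx⟩ := hS
        exact Finset.disjoint_left.1 hd hx (h ▸ Finset.mem_union_left _ hx)
      obtain ⟨s, f, hf, hr, hlab, hadj⟩ := ih S hlt hS
      obtain ⟨t, g, hg, hr', hlab', hadj'⟩ := ih S' hlt' hS'
      have hfS : ∀ x, f x ∈ S := fun x => Finset.mem_coe.1 (hr ▸ Set.mem_range_self x)
      have hgS : ∀ x, g x ∈ S' := fun x => Finset.mem_coe.1 (hr' ▸ Set.mem_range_self x)
      have hinj : Function.Injective (Sum.elim f g) :=
        hf.sumElim hg fun x y => Finset.disjoint_iff_ne.1 hd _ (hfS x) _ (hgS y)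
      have hrange : Set.range (Sum.elim f g) = ((S ∪ S' : Finset V) : Set V) := by
        rw [Set.Sum.elim_range, hr, hr', Finset.coe_union]
      rcases h with h | h
      · -- label `1` is used for the first part while the edges to the second part are added
        refine ⟨.relabel 1 0 (.join 0 1 (by decide) (.union (.relabel 0 1 s) t)), Sum.elim f g,
          hinj, hrange, ?_, ?_⟩
        · have h01 : ∀ i : Fin 2, (if i = 1 then 0 else i) = 0 := by decide
          exact fun x => h01 _
        · have hlabel : ∀ x, (CliqueExpr.relabel 0 1 s).label x = 1 := fun x => by
            show (if s.label x = 0 then 1 else s.label x) = 1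
            rw [if_pos (hlab x)]
          rintro (x | x) (y | y)
          · refine (Iff.intro ?_ Or.inl).trans (hadj x y)
            rintro (h | ⟨-, ⟨h, -⟩ | ⟨h, -⟩⟩)
            · exact h
            · exact absurd ((hlabel x).symm.trans h) (by decide)
            · exact absurd ((hlabel y).symm.trans h) (by decide)
          · refine iff_of_true (Or.inr ⟨Sum.inl_ne_inr, Or.inr ⟨hlab' y, hlabel x⟩⟩) ?_
            exact h _ (hfS x) _ (hgS y)
          · refine iff_of_true (Or.inr ⟨Sum.inr_ne_inl, Or.inl ⟨hlab' x, hlabel y⟩⟩) ?_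
            exact (h _ (hfS y) _ (hgS x)).symm
          · refine (Iff.intro ?_ Or.inl).trans (hadj' x y)
            rintro (h | ⟨-, ⟨-, h⟩ | ⟨-, h⟩⟩)
            · exact h
            · exact absurd ((hlab' y).symm.trans h) (by decide)
            · exact absurd ((hlab' x).symm.trans h) (by decide)
      · refine ⟨.union s t, Sum.elim f g, hinj, hrange, ?_, ?_⟩
        · rintro (x | x)
          · exact hlab x
          · exact hlab' x
        · rintro (x | x) (y | y)
          · exact hadj x y
          · exact iff_of_false CliqueExpr.not_union_adj_inl_inr (h _ (hfS x) _ (hgS y))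
          · exact iff_of_false (fun h' => CliqueExpr.not_union_adj_inl_inr h'.symm)
              fun h' => h _ (hfS y) _ (hgS x) h'.symm
          · exact hadj' x y

theorem IsP4Free.cliqueWidth_le_two {V : Type*} [Finite V] {G : SimpleGraph V}
    (hG : G.IsP4Free) : G.cliqueWidth ≤ 2 := by
  rcases isEmpty_or_nonempty V with hV | hV
  · have : {k | ∃ t : CliqueExpr k, Nonempty (G ≃g t.graph)} = ∅ := by
      refine Set.eq_empty_of_forall_notMem ?_
      rintro k ⟨t, ⟨φ⟩⟩
      exact hV.elim (φ.symm (Classical.arbitrary _))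
    rw [cliqueWidth, this, Nat.sInf_empty]
    exact Nat.zero_le _
  · have := Fintype.ofFinite V
    obtain ⟨t, f, hf, hr, -, hadj⟩ := hG.exists_cliqueExpr Finset.univ Finset.univ_nonempty
    have hf' : Function.Bijective f := ⟨hf, Set.range_eq_univ.1 (by simpa using hr)⟩
    exact Nat.sInf_le ⟨t, ⟨(⟨Equiv.ofBijective f hf', fun {x y} => (hadj x y).symm⟩ :
      t.graph ≃g G).symm⟩⟩

/-! ### Bipartite, split and co-bipartite graphs of large mim-width -/

/-- The vertices are the numbers below `n` and the pairs of them, and each pair is adjacent to its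
two entries. In addition the numbers form a clique if `P` holds, and the pairs form a clique if `Q`
holds. So the graph is bipartite, split or co-bipartite according as none, one or both of `P` and
`Q` hold. -/
def pairGraph (n : ℕ) (P Q : Prop) : SimpleGraph (Fin n ⊕ Fin n × Fin n) where
  Adj
    | .inl i, .inl j => P ∧ i ≠ j
    | .inr p, .inr q => Q ∧ p ≠ q
    | .inl i, .inr p => i = p.1 ∨ i = p.2
    | .inr p, .inl i => i = p.1 ∨ i = p.2
  symm := ⟨by
    rintro (i | p) (j | q) h
    · exact ⟨h.1, h.2.symm⟩
    · exact h
    · exact h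
    · exact ⟨h.1, h.2.symm⟩⟩
  loopless := ⟨by
    rintro (i | p) h
    · exact h.2 rfl
    · exact h.2 rfl⟩

lemma exists_injective_of_le_ncard {α : Type*} [Finite α] {s : Set α} {n : ℕ} (h : n ≤ s.ncard) :
    ∃ a : Fin n → α, Function.Injective a ∧ ∀ t, a t ∈ s := by
  have := Fintype.ofFinite s
  obtain ⟨e⟩ := Function.Embedding.nonempty_of_card_le (α := Fin n) (β := s)
    (by rwa [Fintype.card_fin, ← Nat.card_eq_fintype_card, Nat.card_coe_set_eq])
  exact ⟨fun t => e t, Subtype.val_injective.comp e.injective, fun t => (e t).2⟩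

/-- A cut with `2 * k` of the numbers on either side gives `2 * k` pairs of one number from each
side. Each such pair lies on the side opposite to one of its entries, and at least `k` times it is
the entry on the same side. -/
lemma le_cutMim_pairGraph {n k : ℕ} (P Q : Prop) (A : Set (Fin n ⊕ Fin n × Fin n))
    (h : 2 * k ≤ {i : Fin n | Sum.inl i ∈ A}.ncard)
    (h' : 2 * k ≤ {i : Fin n | Sum.inl i ∉ A}.ncard) : k ≤ (pairGraph n P Q).cutMim A Aᶜ := by
  obtain ⟨a, ha, haA⟩ := exists_injective_of_le_ncard h
  obtain ⟨b, hb, hbA⟩ := exists_injective_of_le_ncard h'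
  have hab : ∀ s t, a s ≠ b t := fun s t h => hbA t (h ▸ haA s)
  let S : Set (Fin (2 * k)) := {t | Sum.inr (a t, b t) ∈ A}
  have hS := Set.ncard_add_ncard_compl S
  rw [Nat.card_fin] at hS
  rcases le_or_gt k S.ncard with hk | hk
  · obtain ⟨t, ht, htS⟩ := exists_injective_of_le_ncard hk
    refine le_cutMim disjoint_compl_right (fun s => .inr (a (t s), b (t s)))
      (fun s => .inl (b (t s))) htS (fun s => hbA _) fun i j => ?_
    show b (t j) = a (t i) ∨ b (t j) = b (t i) ↔ i = j
    rw [hb.eq_iff, ht.eq_iff, or_iff_right (hab _ _).symm, eq_comm]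
  · obtain ⟨t, ht, htS⟩ := exists_injective_of_le_ncard (s := Sᶜ) (n := k) (by omega)
    refine le_cutMim disjoint_compl_right (fun s => .inl (a (t s)))
      (fun s => .inr (a (t s), b (t s))) (fun s => haA _) htS fun i j => ?_
    show a (t i) = a (t j) ∨ a (t i) = b (t j) ↔ i = j
    rw [ha.eq_iff, ht.eq_iff, or_iff_left (hab _ _)]

lemma BranchDecomposition.cutMim_le_mimWidth {V : Type*} (D : BranchDecomposition V)
    (G : SimpleGraph V) {x y : D.Node} (h : D.tree.Adj x y) :
    G.cutMim (D.side x y) (D.side x y)ᶜ ≤ D.mimWidth G := by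
  have := D.finite_node
  have : Finite D.tree.Dart := Finite.of_injective _ Dart.toProd_injective
  exact le_ciSup (f := fun d : D.tree.Dart => G.cutMim (D.side d.fst d.snd) (D.side d.fst d.snd)ᶜ)
    (Set.finite_range _).bddAbove ⟨(x, y), h⟩

theorem le_mimWidth_pairGraph {k : ℕ} (hk : 0 < k) (P Q : Prop) :
    k ≤ (pairGraph (3 * (2 * k)) P Q).mimWidth := by
  have : Nonempty (Fin (3 * (2 * k)) ⊕ Fin (3 * (2 * k)) × Fin (3 * (2 * k))) :=
    ⟨.inl ⟨0, by omega⟩⟩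
  obtain ⟨D₀⟩ := nonempty_branchDecomposition
    (Fin (3 * (2 * k)) ⊕ Fin (3 * (2 * k)) × Fin (3 * (2 * k)))
  refine le_csInf ⟨_, D₀, rfl⟩ ?_
  rintro _ ⟨D, rfl⟩
  have := D.finite_node
  obtain ⟨x, y, hxy, h, h'⟩ := D.isTree.exists_balanced_edge D.subcubic (m := 2 * k) (by omega)
    (fun i => (D.δ (.inl i) : D.Node))
    (fun i j h => Sum.inl_injective (D.δ.injective (Subtype.ext h))) (fun i => (D.δ (.inl i)).2)
  exact (le_cutMim_pairGraph P Q (D.side x y) h h').trans (D.cutMim_le_mimWidth _ hxy)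

/-! ### Graphs that are bipartite, split and co-bipartite -/

/-- Colour classes of a bipartition `c` and of a co-bipartition `d` share at most one vertex each,
so there are at most four vertices, and only the adjacency of vertices that differ in both colours
is not determined. If it depends on the sign of the difference, these vertices form an induced
subgraph of a path on four vertices. -/
lemma isIndContained_pathGraph_of_diagonal {W : Type*} {H : SimpleGraph W} {c d : W → Prop}
    (hc : ∀ u v, H.Adj u v → ¬ (c u ↔ c v)) (hd : ∀ u v, u ≠ v → ¬ H.Adj u v → ¬ (d u ↔ d v))
    (h1 : ∀ u v, ¬ c u → ¬ d u → c v → d v → H.Adj u v)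
    (h2 : ∀ u v, ¬ c u → d u → c v → ¬ d v → ¬ H.Adj u v) :
    H.IsIndContained (pathGraph 4) := by
  classical
  let f : W → Fin 4 := fun u => if c u then (if d u then 2 else 0) else (if d u then 3 else 1)
  have hf : ∀ u v, f u = f v → u = v := by
    intro u v h
    by_contra hne
    have hcd : (c u ↔ c v) ∧ (d u ↔ d v) := by
      by_cases hcu : c u <;> by_cases hcv : c v <;> by_cases hdu : d u <;> by_cases hdv : d v <;>
        simp [f, hcu, hcv, hdu, hdv] at h ⊢
    exact hd u v hne (fun hadj => hc u v hadj hcd.1) hcd.2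
  refine ⟨⟨⟨f, fun u v => hf u v⟩, ?_⟩⟩
  intro u v
  show (pathGraph 4).Adj (f u) (f v) ↔ H.Adj u v
  by_cases huv : u = v
  · subst huv
    simp
  have h3 := hc u v
  have h4 := hd u v huv
  have h5 := h1 u v
  have h6 := h1 v u
  have h7 := h2 u v
  have h8 := h2 v u
  rw [H.adj_comm v u] at h6 h8
  rw [pathGraph_adj]
  clear hc hd h1 h2 hf
  revert h3 h4 h5 h6 h7 h8
  by_cases hcu : c u <;> by_cases hcv : c v <;> by_cases hdu : d u <;> by_cases hdv : d v <;>
    simp [f, hcu, hcv, hdu, hdv]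

/-- If the adjacency of vertices that differ in the bipartition `c` and in the co-bipartition `d`
did not depend on the sign of the difference, the four vertices would induce a cycle or two
disjoint edges, which a split graph does not contain. -/
theorem isIndContained_pathGraph_of_partitions {W : Type*} {H : SimpleGraph W} {c d s : W → Prop}
    (hc : ∀ u v, H.Adj u v → ¬ (c u ↔ c v)) (hd : ∀ u v, u ≠ v → ¬ H.Adj u v → ¬ (d u ↔ d v))
    (hs : ∀ u v, u ≠ v → s u → s v → H.Adj u v) (hs' : ∀ u v, ¬ s u → ¬ s v → ¬ H.Adj u v) :
    H.IsIndContained (pathGraph 4) := by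
  have hone : ∀ u v, (c u ↔ c v) → (d u ↔ d v) → u = v := by
    intro u v h h'
    by_contra hne
    exact hd u v hne (fun hadj => hc u v hadj h) h'
  have hd' : ∀ u v, (d u ↔ d v) → u ≠ v → H.Adj u v := by
    intro u v h hne
    by_contra hadj
    exact hd u v hne hadj h
  by_cases hdiag : (∀ u v, ¬ c u → ¬ d u → c v → d v → H.Adj u v) ∧
      ∀ u v, ¬ c u → d u → c v → ¬ d v → ¬ H.Adj u v
  · exact isIndContained_pathGraph_of_diagonal hc hd hdiag.1 hdiag.2
  · refine isIndContained_pathGraph_of_diagonal (d := fun u => ¬ d u) hc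
      (fun u v hne hadj => not_iff_not.not.2 (hd u v hne hadj)) ?_ ?_
    · intro u v hcu hdu hcv hdv
      rw [not_not] at hdu
      by_contra huv
      refine hdiag ⟨fun u' v' hcu' hdu' hcv' hdv' => ?_, fun u' v' hcu' hdu' hcv' hdv' h => ?_⟩
      · -- otherwise `u v'` and `u' v` are two disjoint edges without an edge between them
        by_contra huv'
        have hne : ∀ {x y}, c x → ¬ c y → y ≠ x := fun hx hy h => hy (h ▸ hx)
        have hne' : ∀ {x y}, d x → ¬ d y → x ≠ y := fun hx hy h => hy (h ▸ hx)
        have huu : ¬ H.Adj u u' := fun h => hc _ _ h (iff_of_false hcu hcu')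
        have hvv : ¬ H.Adj v' v := fun h => hc _ _ h (iff_of_true hcv' hcv)
        have h1 := hd' u v' (iff_of_true hdu hdv') (hne hcv' hcu)
        have h2 := hd' u' v (iff_of_false hdu' hdv) (hne hcv hcu')
        have hs1 : s u ∨ s v' := by
          by_contra! h
          exact hs' _ _ h.1 h.2 h1
        have hs2 : s u' ∨ s v := by
          by_contra! h
          exact hs' _ _ h.1 h.2 h2
        rcases hs1 with h | h <;> rcases hs2 with h' | h'
        · exact huu (hs _ _ (hne' hdu hdu') h h')
        · exact huv (hs _ _ (hne hcv hcu) h h')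
        · exact huv' (hs _ _ (hne hcv' hcu') h' h)
        · exact hvv (hs _ _ (hne' hdv' hdv) h h')
      · rw [hone u u' (iff_of_false hcu hcu') (iff_of_true hdu hdu'),
          hone v v' (iff_of_true hcv hcv') (iff_of_false hdv hdv')] at huv
        exact huv h
    · intro u v hcu hdu hcv hdv huv
      rw [not_not] at hdv
      refine hdiag ⟨fun u' v' hcu' hdu' hcv' hdv' => ?_, fun u' v' hcu' hdu' hcv' hdv' h => ?_⟩
      · rwa [← hone u u' (iff_of_false hcu hcu') (iff_of_false hdu hdu'),
          ← hone v v' (iff_of_true hcv hcv') (iff_of_true hdv hdv')]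
      · -- `u v u' v'` is a cycle of length four without chords
        have h1 := hd' u v' (iff_of_false hdu hdv') fun h => hcu (h ▸ hcv')
        have h2 := hd' u' v (iff_of_true hdu' hdv) fun h => hcu' (h ▸ hcv)
        have hs1 : ¬ s u ∨ ¬ s u' := by
          by_contra! hsu
          exact hc _ _ (hs u u' (fun h => hdu (h ▸ hdu')) hsu.1 hsu.2) (iff_of_false hcu hcu')
        have hs2 : ¬ s v ∨ ¬ s v' := by
          by_contra! hsv
          exact hc _ _ (hs v v' (fun h => hdv' (h ▸ hdv)) hsv.1 hsv.2) (iff_of_true hcv hcv')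
        rcases hs1 with hsu | hsu <;> rcases hs2 with hsv | hsv
        · exact hs' _ _ hsu hsv huv
        · exact hs' _ _ hsu hsv h1
        · exact hs' _ _ hsu hsv h2
        · exact hs' _ _ hsu hsv h

end SimpleGraph

theorem mainTheorem4 {W : Type*} [Finite W] (H : SimpleGraph W) :
    (SimpleGraph.HasBoundedMimWidth (SimpleGraph.freeClass H) ↔
      H.IsIndContained (SimpleGraph.pathGraph 4)) ∧
    (SimpleGraph.HasBoundedMimWidth (SimpleGraph.freeClass H) ↔
      SimpleGraph.HasBoundedCliqueWidth (SimpleGraph.freeClass H)) := by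
  have hmim : SimpleGraph.HasBoundedMimWidth (SimpleGraph.freeClass H) →
      H.IsIndContained (SimpleGraph.pathGraph 4) := by
    rintro ⟨k, hk⟩
    have hemb : ∀ P Q : Prop, H.IsIndContained (SimpleGraph.pairGraph (3 * (2 * (k + 1))) P Q) := by
      intro P Q
      by_contra h
      have h1 := hk _ _ h
      have h2 := SimpleGraph.le_mimWidth_pairGraph k.succ_pos P Q
      exact absurd (h2.trans h1) (by omega)
    obtain ⟨φ⟩ := hemb False False
    obtain ⟨ψ⟩ := hemb True True
    obtain ⟨χ⟩ := hemb True False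
    refine SimpleGraph.isIndContained_pathGraph_of_partitions (c := fun u => (φ u).isLeft)
      (d := fun u => (ψ u).isLeft) (s := fun u => (χ u).isLeft) ?_ ?_ ?_ ?_
    · intro u v h
      rw [← φ.map_adj_iff] at h
      rcases hu : φ u with i | p <;> rcases hv : φ v with j | q <;> rw [hu, hv] at h
      · exact h.1.elim
      · simp
      · simp
      · exact h.1.elim
    · intro u v hne h
      rw [← ψ.map_adj_iff] at h
      replace hne := ψ.injective.ne hne
      rcases hu : ψ u with i | p <;> rcases hv : ψ v with j | q <;> rw [hu, hv] at h hne
      · exact absurd ⟨trivial, fun h => hne (congrArg _ h)⟩ h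
      · simp
      · simp
      · exact absurd ⟨trivial, fun h => hne (congrArg _ h)⟩ h
    · intro u v hne hsu hsv
      obtain ⟨i, hi⟩ := Sum.isLeft_iff.1 hsu
      obtain ⟨j, hj⟩ := Sum.isLeft_iff.1 hsv
      rw [← χ.map_adj_iff]
      replace hne := χ.injective.ne hne
      rw [hi, hj] at hne ⊢
      exact ⟨trivial, fun h => hne (congrArg _ h)⟩
    · intro u v hsu hsv h
      rw [← χ.map_adj_iff] at h
      obtain ⟨p, hp⟩ := Sum.isRight_iff.1 (Sum.not_isLeft.1 hsu)
      obtain ⟨q, hq⟩ := Sum.isRight_iff.1 (Sum.not_isLeft.1 hsv)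
      rw [hp, hq] at h
      exact h.1
  have hcw : H.IsIndContained (SimpleGraph.pathGraph 4) →
      SimpleGraph.HasBoundedCliqueWidth (SimpleGraph.freeClass H) := fun h =>
    ⟨2, fun V _ G hG => (SimpleGraph.isP4Free_of_not_isIndContained
      fun h' => hG (h.trans h')).cliqueWidth_le_two⟩
  have hle : SimpleGraph.HasBoundedCliqueWidth (SimpleGraph.freeClass H) →
      SimpleGraph.HasBoundedMimWidth (SimpleGraph.freeClass H) := fun ⟨k, hk⟩ =>
    ⟨k, fun V _ G hG => G.mimWidth_le_cliqueWidth.trans (hk V G hG)⟩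
  exact ⟨⟨hmim, fun h => hle (hcw h)⟩, ⟨fun h => hcw (hmim h), hle⟩⟩
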